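/- Let $n\ge 1$ and let $A$ be an alternating $n$-quasigroup, that is, a set $A$ with an operation $f\colon A^n\to A$ such that for all $i$, all $y\in A$ and all $x_j\in A$ ($j\ne i$) there is a unique $x_i\in A$ with $f(x_1,\dots,x_n)=y$, and such that $f(x_1,\dots,x_n)=f(x_{\sigma(1)},\dots,x_{\sigma(n)})$ for every even permutation $\sigma$ of $\{1,\dots,n\}$. Write $\operatorname{NCT}(A)$ for the set of those $a\in A^n$ with $f(a)\ne f(a_{\sigma(1)},\dots,a_{\sigma(n)})$ for some permutation $\sigma$ of $\{1,\dots,n\}$. The *NC graph* $\operatorname{NCGr}(A)$ is the simple graph whose vertices are the orbits $a/\mathrm{Alt}_n$ of $\operatorname{NCT}(A)$ under the alternating group permuting entries, in which two distinct orbits $a/\mathrm{Alt}_n$, $b/\mathrm{Alt}_n$ are adjacent when either $\{a_1,\dots,a_n\}=\{b_1,\dots,b_n\}$, or $f(a)=f(b)$ and $|\{a_1,\dots,a_n\}\cap\{b_1,\dots,b_n\}|=n-1$. Let $\underline A=\{\underline x: x\in A\}$ and $\overline A=\{\overline x: x\in A\}$ be two disjoint copies of $A$, and let $\operatorname{Sim}(A)$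 be the simplicial complex whose faces are the subsets of the sets $\{\underline a_1,\dots,\underline a_n,\overline{f(a)}\}$ with $a\in\operatorname{NCT}(A)$. For a set $V$ let $\mathbb R^V$ carry the product topology, and identify $v\in V$ with the corresponding standard basis vector. The *open serenation* $\operatorname{OSer}(A)$ is, as a topological space, the subspace of $\mathbb R^{\underline A\sqcup\overline A}$ that is the union of the open simplices (the interiors of the convex hulls in their affine hulls) spanned by the faces of $\operatorname{Sim}(A)$ with $n$ or $n+1$ elements. The geometric realization $\operatorname{Geo}(\operatorname{NCGr}(A))$ is the subspace of $\mathbb R^{V}$, where $V$ is the vertex set of $\operatorname{NCGr}(A)$, that is the union of the convex hulls of the vertices and of the edges of the graph. Then there is a topological embedding $$\iota\colon\operatorname{Geo}(\operatorname{NCGr}(A))\hookrightarrow\operatorname{OSer}(A)$$ whose image is a strong deformation retract of $\operatorname{OSer}(A)$: there is a continuous map $h\colon\operatorname{OSer}(A)\times[0,1]\to\operatorname{OSer}(A)$ with $h(x,0)=x$ and $h(x,1)\in\operatorname{im}(\iota)$ for all $x\in\operatorname{OSer}(A)$, and $h(x,t)=x$ for all $x\in\operatorname{im}(\iota)$ and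 $t\in[0,1]$. -/

import Mathlib

universe u

open Topology Set

/-- The permutations `σ` of the argument places of an `n`-ary operation `f` under which `f` is
invariant, as a subgroup of the symmetric group. -/
def permutomorphisms {n : ℕ} {A : Type u} (f : (Fin n → A) → A) :
    Subgroup (Equiv.Perm (Fin n)) where
  carrier := {σ | ∀ x : Fin n → A, f (fun i => x (σ i)) = f x}
  one_mem' := fun _ => rfl
  mul_mem' := by
    intro σ τ hσ hτ x
    exact (hτ (fun i => x (σ i))).trans (hσ x)
  inv_mem' := by
    intro σ hσ x
    have h := hσ (fun i => x (σ⁻¹ i))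
    simpa using h.symm

/-- `f` is an `n`-quasigroup operation: in `f(x₁, …, xₙ) = y`, the entry `xᵢ` is uniquely
determined by `y` and the other entries. -/
def IsQuasigroupOp {n : ℕ} {A : Type u} (f : (Fin n → A) → A) : Prop :=
  ∀ (i : Fin n) (x : Fin n → A) (y : A), ∃! z : A, f (Function.update x i z) = y

/-- `(A, f)` is an alternating `n`-quasigroup: an `n`-quasigroup whose operation is invariant
under all even permutations of its arguments. -/
structure IsAlternatingQuasigroup {n : ℕ} {A : Type u} (f : (Fin n → A) → A) : Prop where
  quasigroup : IsQuasigroupOp f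
  alternating : alternatingGroup (Fin n) ≤ permutomorphisms f

/-- The tuple `a` commutes: `f` takes the same value on all rearrangements of `a`. -/
def CommutingTuple {n : ℕ} {A : Type u} (f : (Fin n → A) → A) (a : Fin n → A) : Prop :=
  ∀ σ : Equiv.Perm (Fin n), f a = f (fun i => a (σ i))

/-- The set of noncommuting tuples. -/
def nct {n : ℕ} {A : Type u} (f : (Fin n → A) → A) : Set (Fin n → A) :=
  {a | ¬ CommutingTuple f a}

/-! ### Geometric realizations -/

/-- The simplex vertices: the standard basis vectors of `ℝ^V` labelled by the elements of `γ`. -/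
noncomputable def basisPoints {V : Type u} (γ : Finset V) : Set (V → ℝ) :=
  open Classical in (fun v : V => (Pi.single v (1 : ℝ) : V → ℝ)) '' (γ : Set V)

/-- The closed simplex spanned by `γ`. -/
noncomputable def cvx {V : Type u} (γ : Finset V) : Set (V → ℝ) :=
  convexHull ℝ (basisPoints γ)

/-- The open simplex spanned by `γ`: the interior of the closed simplex in its affine hull. -/
noncomputable def ocvx {V : Type u} (γ : Finset V) : Set (V → ℝ) :=
  intrinsicInterior ℝ (cvx γ)

/-- The closed geometric realization, as a subset of `ℝ^V` (used with its subspace topology).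
The coordinates at elements of `V` which are not vertices of `Γ` vanish at all of its points. -/
noncomputable def geo {V : Type u} (Γ : PreAbstractSimplicialComplex V) : Set (V → ℝ) :=
  ⋃ γ ∈ Γ.faces, cvx γ

/-- The `n`-dimensional open geometric realization: the union of the open simplices of dimension
`n` and `n - 1`, as a subset of `ℝ^V` (used with its subspace topology). -/
noncomputable def openGeo {V : Type u} (n : ℕ) (Γ : PreAbstractSimplicialComplex V) :
    Set (V → ℝ) :=
  ⋃ γ ∈ {γ ∈ Γ.faces | γ.card = n ∨ γ.card = n + 1}, ocvx γ

/-! ### Simplicization and open serenation -/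

/-- The vertex set `{a̲₁, …, a̲ₙ, f(a)‾}`. Here `Sum.inl x` is `x` seen as an input element and
`Sum.inr x` is `x` seen as an output element. -/
def facetVertices {n : ℕ} {A : Type u} (f : (Fin n → A) → A) (a : Fin n → A) : Set (A ⊕ A) :=
  insert (Sum.inr (f a)) (range fun i => Sum.inl (a i))

/-- The simplicization of `(A, f)`: its faces are the nonempty subsets of the sets
`{a̲₁, …, a̲ₙ, f(a)‾}` for noncommuting tuples `a`. -/
def simplicization {n : ℕ} {A : Type u} (f : (Fin n → A) → A) :
    PreAbstractSimplicialComplex (A ⊕ A) where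
  faces := {γ | γ.Nonempty ∧ ∃ a ∈ nct f, (γ : Set (A ⊕ A)) ⊆ facetVertices f a}
  isRelLowerSet_faces := by
    rintro γ ⟨hγ, a, ha, hsub⟩
    refine ⟨hγ, fun δ hδ hne => ⟨hne, a, ha, fun x hx => hsub (hδ hx)⟩⟩

/-- The (underlying topological space of the) open serenation of `(A, f)`. -/
noncomputable def openSerenation {n : ℕ} {A : Type u} (f : (Fin n → A) → A) :
    Set (A ⊕ A → ℝ) :=
  openGeo n (simplicization f)

/-! ### The NC graph -/

/-- Two noncommuting tuples are equivalent when they lie in one orbit of the alternating group,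
acting by permuting entries. -/
def nctSetoid {n : ℕ} {A : Type u} (f : (Fin n → A) → A) : Setoid (nct f) where
  r a b := ∃ σ ∈ alternatingGroup (Fin n), ∀ i, b.1 i = a.1 (σ i)
  iseqv :=
    { refl := fun _ => ⟨1, one_mem _, fun _ => rfl⟩
      symm := by
        rintro a b ⟨σ, hσ, h⟩
        exact ⟨σ⁻¹, inv_mem hσ, fun i => by simp [h]⟩
      trans := by
        rintro a b c ⟨σ, hσ, h⟩ ⟨τ, hτ, h'⟩
        exact ⟨σ * τ, mul_mem hσ hτ, fun i => by simp [h, h']⟩ }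

/-- The vertices of the NC graph: the orbits of noncommuting tuples. -/
abbrev NCVert {n : ℕ} {A : Type u} (f : (Fin n → A) → A) : Type u :=
  Quotient (nctSetoid f)

/-- The NC graph. -/
def ncGraph {n : ℕ} {A : Type u} (f : (Fin n → A) → A) : SimpleGraph (NCVert f) where
  Adj p q := p ≠ q ∧ ∃ a b : nct f,
    Quotient.mk (nctSetoid f) a = p ∧ Quotient.mk (nctSetoid f) b = q ∧
      (range a.1 = range b.1 ∨
        (f a.1 = f b.1 ∧ (range a.1 ∩ range b.1).ncard = n - 1))
  symm := ⟨by
    rintro p q ⟨hne, a, b, ha, hb, h⟩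
    refine ⟨hne.symm, b, a, hb, ha, ?_⟩
    rcases h with h | ⟨h₁, h₂⟩
    · exact Or.inl h.symm
    · exact Or.inr ⟨h₁.symm, by rwa [inter_comm]⟩⟩
  loopless := ⟨fun _ h => h.1 rfl⟩

/-- The geometric realization of a simple graph, seen as the simplicial complex whose faces are
its vertices and its edges. -/
noncomputable def graphGeo {V : Type u} (G : SimpleGraph V) : Set (V → ℝ) :=
  open Classical in
    geo (Geometry.AbstractSimplicialComplex.ofSimpleGraph G).toPreAbstractSimplicialComplex

/-! ### Strong deformation retracts -/

/-- `S` is a strong deformation retract of `X`: some homotopy starts at the identity of `X`, keeps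
the points of `S` fixed at all times and ends with a map into `S`. -/
def IsStrongDeformationRetract {X : Type u} [TopologicalSpace X] (S : Set X) : Prop :=
  ∃ h : X × unitInterval → X, Continuous h ∧ (∀ x, h (x, 0) = x) ∧ (∀ x, h (x, 1) ∈ S) ∧
    ∀ x ∈ S, ∀ t, h (x, t) = x

/-! ### Pseudomanifolds, their facet graphs and half-edges. -/

section DualGraph

open scoped Classical

/-! The NC graph is the dual graph of a pseudomanifold, and removing all faces of codimension at
least two lets a pseudomanifold collapse onto its dual graph.

Combinatorially, an orbit of noncommuting tuples is determined by its set of entries and its value,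
so orbits correspond to the facets of `simplicization f`. Opposite an output vertex, the second
facet comes from the odd rearrangements. Opposite an input vertex, it comes from solving the
quasigroup equation for an odd rearrangement. Hence every codimension one face lies in exactly two
facets (`isPseudomanifold`), and adjacency in the NC graph means sharing such a face
(`ncGraph_adj_iff`).

Geometrically, a point of a cell has at most one zero coordinate. Let `m ≤ M` be its two smallest
coordinates, with `m` at `w`. Lowering all coordinates off `w` to `M` and rescaling gives a point on
the segment from the barycenter of the facet to that of the face opposite `w`, that is, on a
half-edge of the dual graph. Its position depends only on `m / M`. These maps agree on common faces
and glue along locally finite closed covers; the straight-line homotopy to the projection stays in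
each cell. -/

/-- `φ` lists the facets of a pure `n`-dimensional complex, each of whose codimension one faces lies
in exactly two facets. -/
structure IsPseudomanifold {V W : Type u} (n : ℕ) (φ : V → Finset W) : Prop where
  injective : Function.Injective φ
  card : ∀ p, (φ p).card = n + 1
  existsUnique : ∀ p, ∀ w ∈ φ p, ∃! q, q ≠ p ∧ (φ p).erase w ⊆ φ q

/-- The facet opposite to `p` across the codimension one face of `φ p` which omits `w`. -/
noncomputable def nbr {V W : Type u} (φ : V → Finset W) (p : V) (w : W) : V :=
  if h : ∃ q, q ≠ p ∧ (φ p).erase w ⊆ φ q then h.choose else p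

/-- The point of the facet graph at distance `b` from `p` towards `nbr φ p w`. -/
noncomputable def edgePoint {V W : Type u} (φ : V → Finset W) (p : V) (w : W) (b : ℝ) : V → ℝ :=
  fun q => (1 - b) * (Pi.single p 1 : V → ℝ) q + b * (Pi.single (nbr φ p w) 1 : V → ℝ) q

/-- The realization of the facet graph, as a union of half-edges. -/
def halfEdges {V W : Type u} (φ : V → Finset W) : Set (V → ℝ) :=
  {y | ∃ p, ∃ w ∈ φ p, ∃ b : ℝ, 0 ≤ b ∧ b ≤ 1 / 2 ∧ y = edgePoint φ p w b}

/-- The points of the closed simplex spanned by `γ` with at least `n` nonzero coordinates. -/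
structure InCell {W : Type u} (n : ℕ) (γ : Finset W) (x : W → ℝ) : Prop where
  nonneg : ∀ v, 0 ≤ x v
  eq_zero : ∀ v ∉ γ, x v = 0
  finsum_eq : ∑ᶠ v, x v = 1
  le_ncard : n ≤ (Function.support x).ncard

/-- The union of the open simplices of dimension `n` and `n - 1` of a pure complex. -/
def cells {V W : Type u} (n : ℕ) (φ : V → Finset W) : Set (W → ℝ) :=
  {x | ∃ p, InCell n (φ p) x}

/-- The minimum of `x` on `s`, or `0` if `s` is empty. -/
noncomputable def minCoord {W : Type u} (s : Finset W) (x : W → ℝ) : ℝ :=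
  if h : s.Nonempty then s.inf' h x else 0

theorem continuous_minCoord {W : Type u} (s : Finset W) : Continuous (minCoord s) := by
  unfold minCoord
  split_ifs with h
  · exact Continuous.finset_inf'_apply h fun i _ => continuous_apply i
  · exact continuous_const

theorem minCoord_eq {W : Type u} {s : Finset W} {x : W → ℝ} {w : W} (hw : w ∈ s)
    (h : ∀ v ∈ s, x w ≤ x v) : minCoord s x = x w := by
  rw [minCoord, dif_pos ⟨w, hw⟩]
  exact le_antisymm (Finset.inf'_le _ hw) (Finset.le_inf' _ _ h)

theorem exists_minCoord_eq {W : Type u} {s : Finset W} (hs : s.Nonempty) (x : W → ℝ) :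
    ∃ w ∈ s, minCoord s x = x w := by
  obtain ⟨w, hw, h⟩ := s.exists_min_image x hs
  exact ⟨w, hw, minCoord_eq hw h⟩

namespace IsPseudomanifold

variable {V W : Type u} {n : ℕ} {φ : V → Finset W}

theorem nbr_spec (hφ : IsPseudomanifold n φ) {p : V} {w : W} (hw : w ∈ φ p) :
    nbr φ p w ≠ p ∧ (φ p).erase w ⊆ φ (nbr φ p w) := by
  have h := (hφ.existsUnique p w hw).exists
  rw [nbr, dif_pos h]
  exact h.choose_spec

theorem eq_nbr (hφ : IsPseudomanifold n φ) {p q : V} {w : W} (hw : w ∈ φ p) (hne : q ≠ p)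
    (hsub : (φ p).erase w ⊆ φ q) : q = nbr φ p w :=
  (hφ.existsUnique p w hw).unique ⟨hne, hsub⟩ (hφ.nbr_spec hw)

/-- Otherwise one facet would contain the other; having equal cardinality they would coincide,
against injectivity of `φ`. -/
theorem notMem_of_erase_subset (hφ : IsPseudomanifold n φ) {p q : V} {w : W} (hne : q ≠ p)
    (hsub : (φ p).erase w ⊆ φ q) : w ∉ φ q := by
  intro h
  refine hne (hφ.injective (Finset.eq_of_subset_of_card_le (fun v hv => ?_) ?_).symm)
  · by_cases hvw : v = w
    · exact hvw ▸ h
    · exact hsub (Finset.mem_erase.2 ⟨hvw, hv⟩)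
  · rw [hφ.card, hφ.card]

theorem notMem_nbr (hφ : IsPseudomanifold n φ) {p : V} {w : W} (hw : w ∈ φ p) :
    w ∉ φ (nbr φ p w) :=
  hφ.notMem_of_erase_subset (hφ.nbr_spec hw).1 (hφ.nbr_spec hw).2

theorem nbr_inj (hφ : IsPseudomanifold n φ) {p : V} {v w : W} (hv : v ∈ φ p) (hw : w ∈ φ p) :
    nbr φ p v = nbr φ p w ↔ v = w := by
  refine ⟨fun h => ?_, fun h => h ▸ rfl⟩
  by_contra hne
  exact hφ.notMem_nbr hv (h ▸ (hφ.nbr_spec hw).2 (Finset.mem_erase.2 ⟨hne, hv⟩))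

/-- The shared face has `n` vertices, so the opposite facet has exactly one more, `w'`; uniqueness
across `w'` leads back to `p`. -/
theorem exists_nbr_symm (hφ : IsPseudomanifold n φ) {p : V} {w : W} (hw : w ∈ φ p) :
    ∃ w' ∈ φ (nbr φ p w), nbr φ (nbr φ p w) w' = p ∧
      (φ (nbr φ p w)).erase w' = (φ p).erase w := by
  obtain ⟨hne, hsub⟩ := hφ.nbr_spec hw
  have hc : (φ (nbr φ p w) \ (φ p).erase w).card = 1 := by
    rw [Finset.card_sdiff_of_subset hsub, Finset.card_erase_of_mem hw, hφ.card, hφ.card]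
    omega
  obtain ⟨w', hw'⟩ := Finset.card_eq_one.1 hc
  have hmem : w' ∈ φ (nbr φ p w) := (Finset.mem_sdiff.1 (hw' ▸ Finset.mem_singleton_self w')).1
  have heq : (φ (nbr φ p w)).erase w' = (φ p).erase w := by
    rw [← Finset.sdiff_singleton_eq_erase, ← hw', Finset.sdiff_sdiff_eq_self hsub]
  refine ⟨w', hmem, (hφ.eq_nbr hmem hne.symm ?_).symm, heq⟩
  rw [heq]
  exact Finset.erase_subset _ _

theorem edgePoint_self (hφ : IsPseudomanifold n φ) {p : V} {w : W} (hw : w ∈ φ p) (b : ℝ) :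
    edgePoint φ p w b p = 1 - b := by
  simp [edgePoint, Pi.single_eq_of_ne (hφ.nbr_spec hw).1.symm]

theorem edgePoint_nbr (hφ : IsPseudomanifold n φ) {p : V} {v w : W} (hw : w ∈ φ p)
    (hv : v ∈ φ p) (b : ℝ) : edgePoint φ p w b (nbr φ p v) = if v = w then b else 0 := by
  simp [edgePoint, Pi.single_eq_of_ne (hφ.nbr_spec hv).1, Pi.single_apply, hφ.nbr_inj hv hw]

/-- The midpoint weighs both ends equally, so it belongs to the half-edges from either side; this is
the only overlap to check when gluing. -/
theorem edgePoint_half_symm (hφ : IsPseudomanifold n φ) {p : V} {w : W} (hw : w ∈ φ p) :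
    ∃ w' ∈ φ (nbr φ p w), (φ (nbr φ p w)).erase w' = (φ p).erase w ∧
      edgePoint φ (nbr φ p w) w' (1 / 2) = edgePoint φ p w (1 / 2) := by
  obtain ⟨w', hw', h, heq⟩ := hφ.exists_nbr_symm hw
  refine ⟨w', hw', heq, ?_⟩
  funext q
  simp only [edgePoint, h]
  ring

theorem eq_or_eq_nbr_of_edgePoint_pos {p q : V} {w : W} {b : ℝ}
    (h : 0 < edgePoint φ p w b q) : q = p ∨ q = nbr φ p w := by
  by_contra! hne
  simp [edgePoint, Pi.single_eq_of_ne hne.1, Pi.single_eq_of_ne hne.2] at h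

/-- A far end has weight at most `1 / 2`, with equality only at the midpoint, which can be rewritten
from the other side. -/
theorem exists_edgePoint_of_half_le (hφ : IsPseudomanifold n φ) {y : V → ℝ}
    (hy : y ∈ halfEdges φ) {p : V} (hp : 1 / 2 ≤ y p) :
    ∃ w ∈ φ p, ∃ b : ℝ, 0 ≤ b ∧ b ≤ 1 / 2 ∧ y = edgePoint φ p w b := by
  obtain ⟨p', w, hw, b, hb0, hb, rfl⟩ := hy
  rcases eq_or_eq_nbr_of_edgePoint_pos (by linarith : 0 < edgePoint φ p' w b p) with rfl | rfl
  · exact ⟨w, hw, b, hb0, hb, rfl⟩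
  · rw [hφ.edgePoint_nbr hw hw, if_pos rfl] at hp
    obtain rfl : b = 1 / 2 := le_antisymm hb hp
    obtain ⟨w', hw', -, h⟩ := hφ.edgePoint_half_symm hw
    exact ⟨w', hw', 1 / 2, hb0, le_rfl, h.symm⟩

theorem exists_half_le (hφ : IsPseudomanifold n φ) {y : V → ℝ} (hy : y ∈ halfEdges φ) :
    ∃ p, 1 / 2 ≤ y p := by
  obtain ⟨p, w, hw, b, -, hb, rfl⟩ := hy
  exact ⟨p, by rw [hφ.edgePoint_self hw]; linarith⟩

end IsPseudomanifold

theorem InCell.sum_eq {W : Type u} {n : ℕ} {γ : Finset W} {x : W → ℝ} (hx : InCell n γ x) :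
    ∑ v ∈ γ, x v = 1 := by
  rw [← hx.finsum_eq, finsum_eq_sum_of_support_subset]
  intro v hv
  by_contra h
  exact hv (hx.eq_zero v h)

theorem inCell_of_sum {W : Type u} {n : ℕ} {γ : Finset W} {x : W → ℝ} {w : W} (hw : w ∈ γ)
    (hγ : γ.card = n + 1) (hzero : ∀ v ∉ γ, x v = 0) (hsum : ∑ v ∈ γ, x v = 1) (hxw : 0 ≤ x w)
    (hpos : ∀ v ∈ γ.erase w, 0 < x v) : InCell n γ x where
  nonneg v := by
    by_cases hv : v ∈ γ
    · by_cases hvw : v = w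
      · exact hvw ▸ hxw
      · exact (hpos v (Finset.mem_erase.2 ⟨hvw, hv⟩)).le
    · exact (hzero v hv).ge
  eq_zero := hzero
  finsum_eq := by
    rw [← hsum, finsum_eq_sum_of_support_subset]
    intro v hv
    by_contra h
    exact hv (hzero v h)
  le_ncard := by
    have hfin : (Function.support x).Finite := by
      refine γ.finite_toSet.subset fun v hv => ?_
      by_contra h
      exact hv (hzero v h)
    have hsub : ((γ.erase w : Finset W) : Set W) ⊆ Function.support x :=
      fun v hv => (hpos v hv).ne'
    have := Set.ncard_le_ncard hsub hfin
    rw [Set.ncard_coe_finset, Finset.card_erase_of_mem hw, hγ] at this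
    simpa using this

/-- Of `n + 1` coordinates at least `n` are nonzero, so a zero coordinate is unique and must be the
minimum. -/
theorem InCell.exists_min {W : Type u} {n : ℕ} {γ : Finset W} {x : W → ℝ} (hx : InCell n γ x)
    (hγ : γ.card = n + 1) :
    ∃ w ∈ γ, (∀ v ∈ γ, x w ≤ x v) ∧ ∀ v ∈ γ.erase w, 0 < x v := by
  obtain ⟨w, hw, hmin⟩ := γ.exists_min_image x (Finset.card_pos.1 (by omega))
  refine ⟨w, hw, hmin, fun v hv => (hx.nonneg v).lt_of_ne fun h0 => ?_⟩
  have hw0 : x w = 0 :=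
    le_antisymm (h0 ▸ hmin v (Finset.mem_of_mem_erase hv)) (hx.nonneg w)
  have hsub : Function.support x ⊆ (((γ.erase w).erase v : Finset W) : Set W) := by
    intro u hu
    refine Finset.mem_coe.2 (Finset.mem_erase.2 ⟨?_, Finset.mem_erase.2 ⟨?_, ?_⟩⟩)
    · rintro rfl; exact hu h0.symm
    · rintro rfl; exact hu hw0
    · by_contra h; exact hu (hx.eq_zero u h)
  have h1 := Set.ncard_le_ncard hsub (Finset.finite_toSet _)
  rw [Set.ncard_coe_finset, Finset.card_erase_of_mem hv, Finset.card_erase_of_mem hw, hγ] at h1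
  have h2 := hx.le_ncard
  have h3 : 0 < (γ.erase w).card := Finset.card_pos.2 ⟨v, hv⟩
  rw [Finset.card_erase_of_mem hw, hγ] at h3
  omega

/-! ### The projection to the graph and its section, in coordinates. -/

/-- The second smallest value of `x` on `γ`. -/
noncomputable def secondMin {W : Type u} (γ : Finset W) (x : W → ℝ) : ℝ :=
  -- Deleting a vertex other than a chosen minimiser leaves the minimum unchanged, so only the
  -- minimiser's term can be nonzero. Summing over all vertices avoids the choice and keeps the
  -- formula continuous.
  minCoord γ x + ∑ w ∈ γ, (minCoord (γ.erase w) x - minCoord γ x)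

/-- The projection of the cell of `p` to the facet graph. -/
noncomputable def toGraph {V W : Type u} (φ : V → Finset W) (p : V) (x : W → ℝ) : V → ℝ :=
  -- With smallest values `m ≤ M`, the weights are `1 - b` and `b` for `b = (M - m) / (2 * M)`,
  -- which runs from `0` at a tie to `1 / 2` at `m = 0`.
  fun q => (secondMin (φ p) x + minCoord (φ p) x) / (2 * secondMin (φ p) x) *
      (Pi.single p 1 : V → ℝ) q +
    ∑ w ∈ φ p, (minCoord ((φ p).erase w) x - minCoord (φ p) x) / (2 * secondMin (φ p) x) *
      (Pi.single (nbr φ p w) 1 : V → ℝ) q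

/-- The embedding of the half-edges at `p` into the cell of `p`. -/
noncomputable def toCell {V W : Type u} (n : ℕ) (φ : V → Finset W) (p : V) (y : V → ℝ) : W → ℝ :=
  -- On the half-edge towards `w` the numerators are `1`, except `1 - 2 * b` at `w`; the denominator
  -- is their sum `n + 1 - 2 * b`.
  fun v => if v ∈ φ p then (1 - 2 * y (nbr φ p v)) / (n - 1 + 2 * y p) else 0

theorem minCoord_erase_eq {W : Type u} {γ : Finset W} {x : W → ℝ} {v w : W} (hw : w ∈ γ)
    (hmin : ∀ u ∈ γ, x w ≤ x u) (hvw : v ≠ w) : minCoord (γ.erase v) x = x w :=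
  minCoord_eq (Finset.mem_erase.2 ⟨hvw.symm, hw⟩) fun u hu => hmin u (Finset.mem_of_mem_erase hu)

theorem secondMin_eq {W : Type u} {γ : Finset W} {x : W → ℝ} {w : W} (hw : w ∈ γ)
    (hmin : ∀ u ∈ γ, x w ≤ x u) : secondMin γ x = minCoord (γ.erase w) x := by
  rw [secondMin, minCoord_eq hw hmin, Finset.sum_eq_single_of_mem w hw]
  · ring
  · intro v _ hvw
    rw [minCoord_erase_eq hw hmin hvw, sub_self]

theorem continuous_secondMin {W : Type u} (γ : Finset W) : Continuous (secondMin γ) :=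
  (continuous_minCoord _).add <| continuous_finsetSum _ fun _ _ =>
    (continuous_minCoord _).sub (continuous_minCoord _)

/-- Since `1 ≤ n`, the erased facet is nonempty and the default value `0` of `minCoord` does not
occur. -/
theorem minCoord_erase_pos {W : Type u} {n : ℕ} (hn : 1 ≤ n) {γ : Finset W} {x : W → ℝ} {w : W}
    (hγ : γ.card = n + 1) (hw : w ∈ γ) (hpos : ∀ v ∈ γ.erase w, 0 < x v) :
    0 < minCoord (γ.erase w) x := by
  obtain ⟨v, hv, h⟩ := exists_minCoord_eq (s := γ.erase w)
    (Finset.card_pos.1 (by rw [Finset.card_erase_of_mem hw, hγ]; omega)) x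
  exact h ▸ hpos v hv

theorem secondMin_pos {W : Type u} {n : ℕ} (hn : 1 ≤ n) {γ : Finset W} {x : W → ℝ}
    (hγ : γ.card = n + 1) (hx : InCell n γ x) : 0 < secondMin γ x := by
  obtain ⟨w, hw, hmin, hpos⟩ := hx.exists_min hγ
  rw [secondMin_eq hw hmin]
  exact minCoord_erase_pos hn hγ hw hpos

namespace IsPseudomanifold

variable {V W : Type u} {n : ℕ} {φ : V → Finset W}

theorem toGraph_eq (hn : 1 ≤ n) (hφ : IsPseudomanifold n φ) {p : V} {x : W → ℝ} {w : W}
    (hw : w ∈ φ p) (hmin : ∀ u ∈ φ p, x w ≤ x u) (hpos : ∀ v ∈ (φ p).erase w, 0 < x v) :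
    toGraph φ p x = edgePoint φ p w ((minCoord ((φ p).erase w) x - x w) /
      (2 * minCoord ((φ p).erase w) x)) := by
  have hM := minCoord_erase_pos hn (hφ.card p) hw hpos
  funext q
  rw [toGraph, edgePoint, secondMin_eq hw hmin, minCoord_eq hw hmin,
    Finset.sum_eq_single_of_mem w hw]
  · congr 2
    field_simp
    ring
  · intro v _ hvw
    rw [minCoord_erase_eq hw hmin hvw, sub_self, zero_div, zero_mul]

theorem toGraph_eq_half (hn : 1 ≤ n) (hφ : IsPseudomanifold n φ) {p : V} {x : W → ℝ} {w : W}
    (hx : InCell n (φ p) x) (hw : w ∈ φ p) (hw0 : x w = 0)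
    (hpos : ∀ v ∈ (φ p).erase w, 0 < x v) :
    toGraph φ p x = edgePoint φ p w (1 / 2) := by
  rw [hφ.toGraph_eq hn hw (fun u _ => hw0 ▸ hx.nonneg u) hpos, hw0, sub_zero]
  have hM := minCoord_erase_pos hn (hφ.card p) hw hpos
  congr 1
  field_simp

/-- A point common to two cells lies in the open face between them, and both formulas send it to the
midpoint of the edge crossing that face. -/
theorem toGraph_agree (hn : 1 ≤ n) (hφ : IsPseudomanifold n φ) {p q : V} {x : W → ℝ}
    (hp : InCell n (φ p) x) (hq : InCell n (φ q) x) : toGraph φ p x = toGraph φ q x := by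
  by_cases hpq : q = p
  · rw [hpq]
  obtain ⟨w, hw, hmin, hpos⟩ := hp.exists_min (hφ.card p)
  have hsub : (φ p).erase w ⊆ φ q := fun v hv => by
    by_contra h
    exact (hpos v hv).ne' (hq.eq_zero v h)
  obtain rfl := hφ.eq_nbr hw hpq hsub
  have hw0 : x w = 0 := hq.eq_zero w (hφ.notMem_nbr hw)
  obtain ⟨w', hw', heq, h⟩ := hφ.edgePoint_half_symm hw
  have hw0' : x w' = 0 := by
    refine hp.eq_zero w' fun hmem => ?_
    by_cases hww : w' = w
    · exact hφ.notMem_nbr hw (hww ▸ hw')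
    · have : w' ∈ (φ p).erase w := Finset.mem_erase.2 ⟨hww, hmem⟩
      rw [← heq] at this
      exact Finset.notMem_erase _ _ this
  rw [hφ.toGraph_eq_half hn hp hw hw0 hpos, hφ.toGraph_eq_half hn hq hw' hw0' (heq ▸ hpos), h]

theorem toGraph_mem (hn : 1 ≤ n) (hφ : IsPseudomanifold n φ) {p : V} {x : W → ℝ}
    (hx : InCell n (φ p) x) : toGraph φ p x ∈ halfEdges φ ∧ 1 / 2 ≤ toGraph φ p x p := by
  obtain ⟨w, hw, hmin, hpos⟩ := hx.exists_min (hφ.card p)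
  have hM := minCoord_erase_pos hn (hφ.card p) hw hpos
  have hle : x w ≤ minCoord ((φ p).erase w) x := by
    obtain ⟨v, hv, h⟩ := exists_minCoord_eq (s := (φ p).erase w)
      (Finset.card_pos.1 (by rw [Finset.card_erase_of_mem hw, hφ.card]; omega)) x
    rw [h]
    exact hmin v (Finset.mem_of_mem_erase hv)
  have hb : (minCoord ((φ p).erase w) x - x w) / (2 * minCoord ((φ p).erase w) x) ≤ 1 / 2 := by
    rw [div_le_div_iff₀ (by positivity) (by positivity)]
    linarith [hx.nonneg w]
  rw [hφ.toGraph_eq hn hw hmin hpos]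
  refine ⟨⟨p, w, hw, _, div_nonneg (by linarith) (by positivity), hb, rfl⟩, ?_⟩
  rw [hφ.edgePoint_self hw]
  linarith

theorem toCell_edgePoint (hφ : IsPseudomanifold n φ) {p : V} {w : W} (hw : w ∈ φ p) (b : ℝ)
    (v : W) : toCell n φ p (edgePoint φ p w b) v =
      if v ∈ (φ p).erase w then 1 / (n + 1 - 2 * b)
      else if v = w then (1 - 2 * b) / (n + 1 - 2 * b) else 0 := by
  rw [toCell, hφ.edgePoint_self hw]
  have h1 : (n : ℝ) - 1 + 2 * (1 - b) = n + 1 - 2 * b := by ring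
  by_cases hv : v ∈ φ p
  · rw [if_pos hv, hφ.edgePoint_nbr hw hv, h1]
    by_cases hvw : v = w
    · simp [hvw]
    · simp [hvw, hv]
  · have hvw : v ≠ w := fun h => hv (h ▸ hw)
    rw [if_neg hv, if_neg (fun h => hv (Finset.mem_of_mem_erase h)), if_neg hvw]

theorem inCell_toCell_edgePoint (hn : 1 ≤ n) (hφ : IsPseudomanifold n φ) {p : V} {w : W}
    (hw : w ∈ φ p) {b : ℝ} (hb : b ≤ 1 / 2) : InCell n (φ p) (toCell n φ p (edgePoint φ p w b)) := by
  have hn' : (1 : ℝ) ≤ n := by exact_mod_cast hn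
  have hden : 0 < (n : ℝ) + 1 - 2 * b := by linarith
  refine inCell_of_sum hw (hφ.card p) (fun v hv => if_neg hv) ?_ ?_ fun v hv => ?_
  · rw [← Finset.sum_erase_add _ _ hw, Finset.sum_congr rfl fun v hv => by
      rw [hφ.toCell_edgePoint hw, if_pos hv], hφ.toCell_edgePoint hw,
      if_neg (Finset.notMem_erase _ _), if_pos rfl, Finset.sum_const,
      Finset.card_erase_of_mem hw, hφ.card, nsmul_eq_mul, Nat.add_sub_cancel]
    field_simp
    ring
  · rw [hφ.toCell_edgePoint hw, if_neg (Finset.notMem_erase _ _), if_pos rfl]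
    exact div_nonneg (by linarith) hden.le
  · rw [hφ.toCell_edgePoint hw, if_pos hv]
    positivity

theorem toCell_agree (hφ : IsPseudomanifold n φ) {p q : V} {y : V → ℝ} (hy : y ∈ halfEdges φ)
    (hp : 1 / 2 ≤ y p) (hq : 1 / 2 ≤ y q) : toCell n φ p y = toCell n φ q y := by
  by_cases hpq : q = p
  · rw [hpq]
  obtain ⟨w, hw, b, hb0, hb, rfl⟩ := hφ.exists_edgePoint_of_half_le hy hp
  obtain rfl := (eq_or_eq_nbr_of_edgePoint_pos (by linarith)).resolve_left hpq
  rw [hφ.edgePoint_nbr hw hw, if_pos rfl] at hq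
  obtain rfl : b = 1 / 2 := le_antisymm hb hq
  obtain ⟨w', hw', heq, h⟩ := hφ.edgePoint_half_symm hw
  funext v
  rw [hφ.toCell_edgePoint hw, ← h, hφ.toCell_edgePoint hw', heq]
  simp

theorem toGraph_toCell (hn : 1 ≤ n) (hφ : IsPseudomanifold n φ) {y : V → ℝ}
    (hy : y ∈ halfEdges φ) {p : V} (hp : 1 / 2 ≤ y p) : toGraph φ p (toCell n φ p y) = y := by
  obtain ⟨w, hw, b, hb0, hb, rfl⟩ := hφ.exists_edgePoint_of_half_le hy hp
  have hn' : (1 : ℝ) ≤ n := by exact_mod_cast hn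
  have hden : 0 < (n : ℝ) + 1 - 2 * b := by linarith
  have hxw : toCell n φ p (edgePoint φ p w b) w = (1 - 2 * b) / (n + 1 - 2 * b) := by
    rw [hφ.toCell_edgePoint hw, if_neg (Finset.notMem_erase _ _), if_pos rfl]
  have hxv : ∀ v ∈ (φ p).erase w,
      toCell n φ p (edgePoint φ p w b) v = 1 / (n + 1 - 2 * b) := fun v hv => by
    rw [hφ.toCell_edgePoint hw, if_pos hv]
  have hM : minCoord ((φ p).erase w) (toCell n φ p (edgePoint φ p w b)) =
      1 / (n + 1 - 2 * b) := by
    obtain ⟨v, hv, h⟩ := exists_minCoord_eq (s := (φ p).erase w)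
      (Finset.card_pos.1 (by rw [Finset.card_erase_of_mem hw, hφ.card]; omega))
      (toCell n φ p (edgePoint φ p w b))
    rw [h, hxv v hv]
  rw [hφ.toGraph_eq hn hw, hM, hxw]
  -- The ratio of the two smallest coordinates is `1 - 2 * b`, from which `b` is recovered.
  · congr 1
    field_simp
    ring
  · intro u hu
    by_cases huw : u = w
    · rw [huw]
    · rw [hxw, hxv u (Finset.mem_erase.2 ⟨huw, hu⟩)]
      gcongr
      linarith
  · intro v hv
    rw [hxv v hv]
    positivity

/-- The segment from a point of a cell to its projection stays in the cell. -/
theorem inCell_segment (hn : 1 ≤ n) (hφ : IsPseudomanifold n φ) {p : V} {x : W → ℝ}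
    (hx : InCell n (φ p) x) {t : ℝ} (ht0 : 0 ≤ t) (ht1 : t ≤ 1) :
    InCell n (φ p) fun v => (1 - t) * x v + t * toCell n φ p (toGraph φ p x) v := by
  obtain ⟨w, hw, hmin, hpos⟩ := hx.exists_min (hφ.card p)
  have hM := minCoord_erase_pos hn (hφ.card p) hw hpos
  have hb : (minCoord ((φ p).erase w) x - x w) / (2 * minCoord ((φ p).erase w) x) ≤ 1 / 2 := by
    rw [div_le_div_iff₀ (by positivity) (by positivity)]
    linarith [hx.nonneg w]
  rw [hφ.toGraph_eq hn hw hmin hpos]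
  set b := (minCoord ((φ p).erase w) x - x w) / (2 * minCoord ((φ p).erase w) x)
  have hz := hφ.inCell_toCell_edgePoint hn hw hb
  have hn' : (1 : ℝ) ≤ n := by exact_mod_cast hn
  have hden : 0 < (n : ℝ) + 1 - 2 * b := by linarith
  -- The point and its projection are both positive off the same `w`, so only the coordinate at `w`
  -- can vanish along the segment.
  refine inCell_of_sum hw (hφ.card p) (fun v hv => ?_) ?_ ?_ fun v hv => ?_
  · rw [hx.eq_zero v hv, hz.eq_zero v hv]
    ring
  · rw [Finset.sum_add_distrib, ← Finset.mul_sum, ← Finset.mul_sum, hx.sum_eq, hz.sum_eq]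
    ring
  · exact add_nonneg (mul_nonneg (by linarith) (hx.nonneg w)) (mul_nonneg ht0 (hz.nonneg w))
  · rw [hφ.toCell_edgePoint hw, if_pos hv]
    have h1 : 0 < 1 / ((n : ℝ) + 1 - 2 * b) := by positivity
    rcases ht0.eq_or_lt with rfl | ht
    · simpa using hpos v hv
    · have h2 := mul_pos ht h1
      have h3 := mul_nonneg (by linarith : 0 ≤ 1 - t) (hpos v hv).le
      linarith

/-! ### Gluing along locally finite closed covers. -/

/-- Positivity of the coordinates off a minimiser `w` is an open condition, and it forces any cell
met to contain the face opposite `w`; only two do. -/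
theorem locallyFinite_inCell (hφ : IsPseudomanifold n φ) :
    LocallyFinite fun p => {x : cells n φ | InCell n (φ p) x} := by
  rintro ⟨x, p, hx⟩
  obtain ⟨w, hw, -, hpos⟩ := hx.exists_min (hφ.card p)
  refine ⟨{z | ∀ v ∈ (φ p).erase w, 0 < z.1 v}, ?_, ({p, nbr φ p w} : Set V).toFinite.subset ?_⟩
  · refine IsOpen.mem_nhds ?_ hpos
    simp only [ofPred_forall]
    exact isOpen_biInter_finset fun v _ =>
      isOpen_lt continuous_const ((continuous_apply v).comp continuous_subtype_val)
  · rintro q ⟨z, hz, hzpos⟩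
    by_cases hqp : q = p
    · exact Or.inl hqp
    · refine Or.inr (hφ.eq_nbr hw hqp fun v hv => ?_)
      by_contra h
      exact (hzpos v hv).ne' (InCell.eq_zero hz v h)

/-- Within `cells n φ` only vanishing off `φ p` depends on `p`. -/
theorem isClosed_inCell (p : V) :
    IsClosed {x : cells n φ | InCell n (φ p) x} := by
  have : {x : cells n φ | InCell n (φ p) x} = ⋂ v ∈ {v | v ∉ φ p}, {x | x.1 v = 0} := by
    ext ⟨x, q, hx⟩
    simp only [mem_iInter]
    exact ⟨fun h => h.eq_zero, fun h => ⟨hx.nonneg, h, hx.finsum_eq, hx.le_ncard⟩⟩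
  rw [this]
  exact isClosed_biInter fun v _ =>
    isClosed_eq ((continuous_apply v).comp continuous_subtype_val) continuous_const

theorem continuousOn_toGraph (hn : 1 ≤ n) (hφ : IsPseudomanifold n φ) (p : V) :
    ContinuousOn (toGraph φ p) {x | InCell n (φ p) x} := by
  refine continuousOn_pi.2 fun q => ?_
  have hM := (continuous_secondMin (φ p)).continuousOn (s := {x | InCell n (φ p) x})
  have hden : ∀ x ∈ {x | InCell n (φ p) x}, 2 * secondMin (φ p) x ≠ 0 := fun x hx =>
    (mul_pos two_pos (secondMin_pos hn (hφ.card p) hx)).ne'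
  refine ContinuousOn.add (ContinuousOn.mul (ContinuousOn.div ?_ ?_ hden) continuousOn_const)
    (continuousOn_finsetSum _ fun w _ =>
      ContinuousOn.mul (ContinuousOn.div ?_ ?_ hden) continuousOn_const)
  · exact hM.add (continuous_minCoord _).continuousOn
  · exact continuousOn_const.mul hM
  · exact ((continuous_minCoord _).sub (continuous_minCoord _)).continuousOn
  · exact continuousOn_const.mul hM

/-- Where the coordinate at `p` is positive, the near end of the half-edge is `p` or one of its
finitely many neighbours, even when the whole graph is infinite. -/
theorem locallyFinite_half_le (hφ : IsPseudomanifold n φ) :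
    LocallyFinite fun p => {y : halfEdges φ | 1 / 2 ≤ y.1 p} := by
  rintro ⟨y, hy⟩
  obtain ⟨p, hp⟩ := hφ.exists_half_le hy
  refine ⟨{z | 0 < z.1 p}, IsOpen.mem_nhds ?_ (by simp only [mem_ofPred_eq]; linarith),
    ((insert p ((φ p).image (nbr φ p)) : Finset V) : Set V).toFinite.subset ?_⟩
  · exact isOpen_lt continuous_const ((continuous_apply p).comp continuous_subtype_val)
  · rintro q ⟨⟨z, hz⟩, hzq, hzp⟩
    obtain ⟨w, hw, b, -, -, rfl⟩ := hφ.exists_edgePoint_of_half_le hz hzq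
    simp only [Finset.coe_insert, Finset.coe_image, mem_insert_iff, mem_image, Finset.mem_coe]
    rcases eq_or_eq_nbr_of_edgePoint_pos hzp with rfl | rfl
    · exact Or.inl rfl
    · obtain ⟨w', hw', h, -⟩ := hφ.exists_nbr_symm hw
      exact Or.inr ⟨w', hw', h⟩

theorem continuousOn_toCell (hn : 1 ≤ n) (p : V) :
    ContinuousOn (toCell n φ p) {y | 1 / 2 ≤ y p} := by
  have hn' : (1 : ℝ) ≤ n := by exact_mod_cast hn
  refine continuousOn_pi.2 fun v => ?_
  unfold toCell
  split_ifs with hv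
  · refine ContinuousOn.div (by fun_prop) (by fun_prop) fun y hy => ?_
    have : 1 / 2 ≤ y p := hy
    linarith
  · exact continuousOn_const

theorem toCell_mem (hn : 1 ≤ n) (hφ : IsPseudomanifold n φ) {y : V → ℝ} (hy : y ∈ halfEdges φ)
    {p : V} (hp : 1 / 2 ≤ y p) : InCell n (φ p) (toCell n φ p y) := by
  obtain ⟨w, hw, b, -, hb, rfl⟩ := hφ.exists_edgePoint_of_half_le hy hp
  exact hφ.inCell_toCell_edgePoint hn hw hb

theorem exists_retraction (hn : 1 ≤ n) (hφ : IsPseudomanifold n φ) :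
    ∃ g : cells n φ → halfEdges φ, Continuous g ∧
      ∀ p, ∀ x : cells n φ, InCell n (φ p) x → (g x).1 = toGraph φ p x := by
  have hval : ∀ p, ∀ x : cells n φ, InCell n (φ p) x →
      toGraph φ x.2.choose x = toGraph φ p x := fun p x hx =>
    hφ.toGraph_agree hn x.2.choose_spec hx
  refine ⟨fun x => ⟨toGraph φ x.2.choose x, (hφ.toGraph_mem hn x.2.choose_spec).1⟩, ?_, hval⟩
  refine Continuous.subtype_mk ((hφ.locallyFinite_inCell).continuous ?_ isClosed_inCell
    fun p => ?_) _
  · exact eq_univ_of_forall fun x => mem_iUnion.2 x.2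
  · exact ((hφ.continuousOn_toGraph hn p).comp continuous_subtype_val.continuousOn
      fun x hx => hx).congr fun x hx => hval p x hx

theorem exists_section (hn : 1 ≤ n) (hφ : IsPseudomanifold n φ) :
    ∃ i : halfEdges φ → cells n φ, Continuous i ∧
      ∀ p, ∀ y : halfEdges φ, 1 / 2 ≤ y.1 p → (i y).1 = toCell n φ p y := by
  have hex : ∀ y : halfEdges φ, ∃ p, 1 / 2 ≤ y.1 p := fun y => hφ.exists_half_le y.2
  have hval : ∀ p, ∀ y : halfEdges φ, 1 / 2 ≤ y.1 p →
      toCell n φ (hex y).choose y = toCell n φ p y := fun p y hy =>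
    hφ.toCell_agree y.2 (hex y).choose_spec hy
  refine ⟨fun y => ⟨toCell n φ (hex y).choose y, _, hφ.toCell_mem hn y.2 (hex y).choose_spec⟩,
    ?_, hval⟩
  refine Continuous.subtype_mk (hφ.locallyFinite_half_le.continuous ?_ (fun p => ?_)
    fun p => ?_) _
  · exact eq_univ_of_forall fun y => mem_iUnion.2 (hex y)
  · exact isClosed_le continuous_const ((continuous_apply p).comp continuous_subtype_val)
  · exact ((continuousOn_toCell hn p).comp continuous_subtype_val.continuousOn
      fun y hy => hy).congr fun y hy => hval p y hy

/-- The facet graph of a pseudomanifold embeds as a strong deformation retract of the union of the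
open simplices of codimension at most one. -/
theorem exists_isStrongDeformationRetract (hn : 1 ≤ n) (hφ : IsPseudomanifold n φ) :
    ∃ i : halfEdges φ → cells n φ, IsEmbedding i ∧ IsStrongDeformationRetract (range i) := by
  obtain ⟨g, hgc, hg⟩ := hφ.exists_retraction hn
  obtain ⟨i, hic, hi⟩ := hφ.exists_section hn
  have hgi : Function.LeftInverse g i := fun y => by
    obtain ⟨p, hp⟩ := hφ.exists_half_le y.2
    refine Subtype.ext ?_
    have hc : InCell n (φ p) (i y).1 := hi p y hp ▸ hφ.toCell_mem hn y.2 hp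
    rw [hg p _ hc, hi p y hp, hφ.toGraph_toCell hn y.2 hp]
  have hig : ∀ p, ∀ x : cells n φ, InCell n (φ p) x →
      (i (g x)).1 = toCell n φ p (toGraph φ p x) := fun p x hx => by
    rw [hi p _ (hg p x hx ▸ (hφ.toGraph_mem hn hx).2), hg p x hx]
  -- `g` is a continuous left inverse, so `i` is an embedding; the homotopy is the segment from a
  -- point to its image under `i ∘ g`.
  refine ⟨i, hgi.isEmbedding hgc hic, fun z => ⟨fun v =>
    (1 - (z.2 : ℝ)) * z.1.1 v + z.2 * (i (g z.1)).1 v, ?_⟩, ?_, ?_, ?_, ?_⟩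
  · obtain ⟨p, hp⟩ := z.1.2
    refine ⟨p, ?_⟩
    rw [hig p z.1 hp]
    exact hφ.inCell_segment hn hp z.2.2.1 z.2.2.2
  · have h2 : Continuous fun z : cells n φ × unitInterval => (i (g z.1)).1 :=
      continuous_subtype_val.comp (hic.comp (hgc.comp continuous_fst))
    refine Continuous.subtype_mk (continuous_pi fun v => ?_) _
    have h3 := (continuous_apply v).comp h2
    have h4 : Continuous fun z : cells n φ × unitInterval => z.1.1 v :=
      (continuous_apply v).comp (continuous_subtype_val.comp continuous_fst)
    have h5 : Continuous fun z : cells n φ × unitInterval => (z.2 : ℝ) :=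
      continuous_subtype_val.comp continuous_snd
    exact ((continuous_const.sub h5).mul h4).add (h5.mul h3)
  · intro x
    refine Subtype.ext (funext fun v => ?_)
    simp
  · intro x
    refine ⟨g x, Subtype.ext (funext fun v => ?_)⟩
    simp
  · rintro _ ⟨y, rfl⟩ t
    refine Subtype.ext (funext fun v => ?_)
    simp only [hgi y]
    ring

end IsPseudomanifold

end DualGraph

/-! ### Geometric realizations in coordinates. -/

section Realization

open scoped Classical

theorem sum_mul_single {V : Type u} {γ : Finset V} {x : V → ℝ} (h : ∀ v ∉ γ, x v = 0) :
    ∑ v ∈ γ, x v • (Pi.single v (1 : ℝ) : V → ℝ) = x := by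
  funext u
  simp only [Finset.sum_apply, Pi.smul_apply, Pi.single_apply, smul_eq_mul, mul_ite, mul_one,
    mul_zero, Finset.sum_ite_eq]
  split_ifs with hu
  · rfl
  · exact (h u hu).symm

theorem cvx_eq {V : Type u} (γ : Finset V) :
    cvx γ = {x | (∀ v, 0 ≤ x v) ∧ (∀ v ∉ γ, x v = 0) ∧ ∑ v ∈ γ, x v = 1} := by
  apply Subset.antisymm
  · refine convexHull_min ?_ ?_
    · rintro _ ⟨w, hw, rfl⟩
      refine ⟨fun v => ?_, fun v hv => ?_, ?_⟩
      · beta_reduce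
        rw [Pi.single_apply]
        split_ifs <;> norm_num
      · have hvw : v ≠ w := fun h => hv (h ▸ hw)
        exact Pi.single_eq_of_ne hvw _
      · simpa [Pi.single_apply] using hw
    · rintro x ⟨hx0, hx, hxs⟩ y ⟨hy0, hy, hys⟩ a b ha hb hab
      refine ⟨fun v => ?_, fun v hv => ?_, ?_⟩
      · exact add_nonneg (mul_nonneg ha (hx0 v)) (mul_nonneg hb (hy0 v))
      · simp [hx v hv, hy v hv]
      · simp only [Pi.add_apply, Pi.smul_apply, smul_eq_mul]
        rw [Finset.sum_add_distrib, ← Finset.mul_sum, ← Finset.mul_sum, hxs, hys]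
        linarith
  · rintro x ⟨hx0, hx, hxs⟩
    rw [← sum_mul_single hx]
    exact (convex_convexHull ℝ _).sum_mem (fun v _ => hx0 v) hxs
      fun v hv => subset_convexHull ℝ _ ⟨v, hv, rfl⟩

theorem mem_cvx {V : Type u} {γ : Finset V} {x : V → ℝ} :
    x ∈ cvx γ ↔ (∀ v, 0 ≤ x v) ∧ (∀ v ∉ γ, x v = 0) ∧ ∑ v ∈ γ, x v = 1 := by
  rw [cvx_eq]
  rfl

theorem affineSpan_cvx_spec {V : Type u} {γ : Finset V} {x : V → ℝ}
    (hx : x ∈ affineSpan ℝ (cvx γ)) : (∀ v ∉ γ, x v = 0) ∧ ∑ v ∈ γ, x v = 1 := by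
  refine affineSpan_induction (p := fun x => (∀ v ∉ γ, x v = 0) ∧ ∑ v ∈ γ, x v = 1) hx
    (fun x hx => (mem_cvx.1 hx).2) fun c u v w hu hv hw => ?_
  refine ⟨fun i hi => ?_, ?_⟩
  · simp [hu.1 i hi, hv.1 i hi, hw.1 i hi]
  · simp only [vsub_eq_sub, vadd_eq_add, Pi.add_apply, Pi.smul_apply, Pi.sub_apply, smul_eq_mul]
    rw [Finset.sum_add_distrib, ← Finset.mul_sum, Finset.sum_sub_distrib, hu.2, hv.2, hw.2]
    ring

theorem ocvx_eq {V : Type u} (γ : Finset V) :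
    ocvx γ = {x | (∀ v ∈ γ, 0 < x v) ∧ (∀ v ∉ γ, x v = 0) ∧ ∑ v ∈ γ, x v = 1} := by
  ext x
  rw [ocvx, mem_intrinsicInterior]
  constructor
  · rintro ⟨⟨x, hx⟩, hint, rfl⟩
    refine ⟨fun v hv => ?_, affineSpan_cvx_spec hx⟩
    have hxc : (⟨x, hx⟩ : affineSpan ℝ (cvx γ)) ∈ Subtype.val ⁻¹' cvx γ := interior_subset hint
    refine ((mem_cvx.1 hxc).1 v).lt_of_ne fun h0 => ?_
    have hs : (Pi.single v 1 : V → ℝ) ∈ affineSpan ℝ (cvx γ) :=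
      subset_affineSpan ℝ _ (subset_convexHull ℝ _ ⟨v, hv, rfl⟩)
    -- Moving from `x` directly away from the vertex `v` stays in the affine span but makes the
    -- `v`-coordinate `-t`, so a point with a zero coordinate is not interior.
    let c : ℝ → affineSpan ℝ (cvx γ) := fun t =>
      ⟨AffineMap.lineMap x (Pi.single v 1) (-t), AffineMap.lineMap_mem _ hx hs⟩
    have hc : Continuous c :=
      Continuous.subtype_mk (AffineMap.lineMap_continuous.comp continuous_neg) _
    have hc0 : c 0 = ⟨x, hx⟩ := Subtype.ext (by simp [c])
    have hev : ∀ᶠ t in 𝓝 (0 : ℝ), (c t).1 ∈ cvx γ :=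
      (hc.tendsto 0).eventually (by rw [hc0]; exact mem_interior_iff_mem_nhds.1 hint)
    obtain ⟨t, ht, hpos⟩ := ((hev.filter_mono nhdsWithin_le_nhds).and
      (self_mem_nhdsWithin : Ioi (0 : ℝ) ∈ 𝓝[>] 0)).exists
    have := (mem_cvx.1 ht).1 v
    have hxv : x v = 0 := h0.symm
    simp only [c, AffineMap.lineMap_apply, vsub_eq_sub, vadd_eq_add, Pi.add_apply, Pi.smul_apply,
      Pi.sub_apply, smul_eq_mul, Pi.single_eq_same, hxv] at this
    have hpos' : 0 < t := hpos
    linarith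
  · rintro ⟨hpos, hz, hs⟩
    have hmem : x ∈ cvx γ := by
      rw [cvx_eq]
      refine ⟨fun v => ?_, hz, hs⟩
      by_cases hv : v ∈ γ
      · exact (hpos v hv).le
      · exact (hz v hv).ge
    refine ⟨⟨x, subset_affineSpan ℝ _ hmem⟩, ?_, rfl⟩
    refine mem_interior.2 ⟨{z | ∀ v ∈ γ, 0 < z.1 v}, ?_, ?_, hpos⟩
    · rintro ⟨z, hz⟩ hzpos
      have h := affineSpan_cvx_spec hz
      refine mem_cvx.2 ⟨fun v => ?_, h⟩
      by_cases hv : v ∈ γ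
      · exact (hzpos v hv).le
      · exact (h.1 v hv).ge
    · simp only [ofPred_forall]
      exact isOpen_biInter_finset fun v _ =>
        isOpen_lt continuous_const ((continuous_apply v).comp continuous_subtype_val)

theorem openGeo_eq_cells {V W : Type u} {n : ℕ} (hn : 1 ≤ n) {φ : V → Finset W}
    (hcard : ∀ p, (φ p).card = n + 1) {Γ : PreAbstractSimplicialComplex W}
    (hΓ : ∀ γ, γ ∈ Γ.faces ↔ γ.Nonempty ∧ ∃ p, γ ⊆ φ p) : openGeo n Γ = cells n φ := by
  ext x
  simp only [openGeo, mem_iUnion, ocvx_eq]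
  constructor
  · rintro ⟨γ, ⟨hγ, hγn⟩, hpos, hz, hs⟩
    obtain ⟨-, p, hp⟩ := (hΓ γ).1 hγ
    have hsupp : Function.support x = γ := by
      ext v
      refine ⟨fun hv => ?_, fun hv => (hpos v hv).ne'⟩
      by_contra h
      exact hv (hz v h)
    refine ⟨p, fun v => ?_, fun v hv => hz v fun h => hv (hp h), ?_, ?_⟩
    · by_cases hv : v ∈ γ
      · exact (hpos v hv).le
      · exact (hz v hv).ge
    · rw [finsum_eq_sum_of_support_subset x hsupp.subset, hs]
    · rw [hsupp, Set.ncard_coe_finset]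
      omega
  · rintro ⟨p, hx⟩
    have hsupp : Function.support x = ((φ p).filter fun v => x v ≠ 0 : Finset W) := by
      ext v
      simp only [Function.mem_support, Finset.coe_filter, mem_ofPred_eq]
      refine ⟨fun hv => ⟨?_, hv⟩, fun hv => hv.2⟩
      by_contra h
      exact hv (hx.eq_zero v h)
    have hle := hx.le_ncard
    rw [hsupp, Set.ncard_coe_finset] at hle
    have hle' := Finset.card_filter_le (φ p) fun v => x v ≠ 0
    rw [hcard] at hle'
    refine ⟨(φ p).filter fun v => x v ≠ 0, ⟨(hΓ _).2 ⟨Finset.card_pos.1 (by omega), p,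
      Finset.filter_subset _ _⟩, by omega⟩, fun v hv => ?_, fun v hv => ?_, ?_⟩
    · exact (hx.nonneg v).lt_of_ne (Finset.mem_filter.1 hv).2.symm
    · by_contra h
      exact hv (Finset.mem_coe.1 (hsupp ▸ (h : v ∈ Function.support x)))
    · rw [← finsum_eq_sum_of_support_subset x hsupp.subset, hx.finsum_eq]

theorem mem_cvx_pair {V : Type u} {p q : V} {y : V → ℝ} :
    y ∈ cvx {p, q} ↔ ∃ a b : ℝ, 0 ≤ a ∧ 0 ≤ b ∧ a + b = 1 ∧
      y = fun r => a * (Pi.single p 1 : V → ℝ) r + b * (Pi.single q 1 : V → ℝ) r := by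
  rw [cvx, basisPoints, Finset.coe_pair, image_pair, convexHull_pair, segment]
  constructor
  · rintro ⟨a, b, ha, hb, hab, rfl⟩
    exact ⟨a, b, ha, hb, hab, rfl⟩
  · rintro ⟨a, b, ha, hb, hab, rfl⟩
    exact ⟨a, b, ha, hb, hab, rfl⟩

theorem graphGeo_eq_halfEdges {V W : Type u} {n : ℕ} {φ : V → Finset W}
    (hφ : IsPseudomanifold n φ) {G : SimpleGraph V}
    (hG : ∀ p q, G.Adj p q ↔ p ≠ q ∧ ∃ w ∈ φ p, (φ p).erase w ⊆ φ q) :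
    graphGeo G = halfEdges φ := by
  have hedge : ∀ p q, G.Adj p q → ∀ a b : ℝ, 0 ≤ b → b ≤ a → a + b = 1 →
      (fun r => a * (Pi.single p 1 : V → ℝ) r + b * (Pi.single q 1 : V → ℝ) r) ∈
        halfEdges φ := by
    intro p q hpq a b hb hba hab
    obtain ⟨hne, w, hw, hsub⟩ := (hG p q).1 hpq
    obtain rfl := hφ.eq_nbr hw hne.symm hsub
    refine ⟨p, w, hw, b, hb, by linarith, ?_⟩
    obtain rfl : a = 1 - b := by linarith
    rfl
  ext y
  simp only [graphGeo, geo, mem_iUnion]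
  constructor
  · rintro ⟨γ, hγ, hy⟩
    rcases hγ with ⟨p, rfl⟩ | ⟨e, he, rfl⟩
    · rw [cvx, basisPoints, Finset.coe_singleton, image_singleton, convexHull_singleton] at hy
      -- Every facet has a vertex, hence a neighbour, so a vertex of the graph is the point `b = 0`
      -- of some half-edge.
      obtain ⟨w, hw⟩ : (φ p).Nonempty := Finset.card_pos.1 (by rw [hφ.card]; omega)
      refine ⟨p, w, hw, 0, le_rfl, by norm_num, ?_⟩
      rw [mem_singleton_iff.1 hy]
      funext q
      simp [edgePoint]
    · induction e with
      | h p q =>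
        have hpq : G.Adj p q := he
        rw [Sym2.toFinset_mk_eq, mem_cvx_pair] at hy
        obtain ⟨a, b, ha, hb, hab, rfl⟩ := hy
        rcases le_total b a with h | h
        · exact hedge p q hpq a b hb h hab
        · have := hedge q p hpq.symm b a ha h (by linarith)
          simpa only [add_comm] using this
  · rintro ⟨p, w, hw, b, hb0, hb, rfl⟩
    have hadj : G.Adj p (nbr φ p w) :=
      (hG _ _).2 ⟨(hφ.nbr_spec hw).1.symm, w, hw, (hφ.nbr_spec hw).2⟩
    refine ⟨{p, nbr φ p w}, Or.inr ⟨s(p, nbr φ p w), hadj, Sym2.toFinset_mk_eq⟩, ?_⟩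
    exact mem_cvx_pair.2 ⟨1 - b, b, by linarith, hb0, by ring, rfl⟩

end Realization

/-! ### Alternating quasigroups and the facets of their simplicization. -/

section Alternating

variable {n : ℕ} {A : Type u} {f : (Fin n → A) → A}

theorem IsAlternatingQuasigroup.apply_comp_even (hf : IsAlternatingQuasigroup f)
    {σ : Equiv.Perm (Fin n)} (hσ : Equiv.Perm.sign σ = 1) (a : Fin n → A) : f (a ∘ σ) = f a :=
  hf.alternating (Equiv.Perm.mem_alternatingGroup.2 hσ) a

theorem sign_eq_neg_one {σ : Equiv.Perm (Fin n)} (hσ : Equiv.Perm.sign σ ≠ 1) :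
    Equiv.Perm.sign σ = -1 :=
  (Int.units_eq_one_or _).resolve_left hσ

/-- All odd rearrangements of a tuple have the same value. -/
theorem IsAlternatingQuasigroup.apply_comp_odd (hf : IsAlternatingQuasigroup f)
    {σ τ : Equiv.Perm (Fin n)} (hσ : Equiv.Perm.sign σ = -1) (hτ : Equiv.Perm.sign τ = -1)
    (a : Fin n → A) : f (a ∘ σ) = f (a ∘ τ) := by
  have h := hf.apply_comp_even (σ := σ⁻¹ * τ) (by simp [hσ, hτ]) (a ∘ σ)
  rw [← h]
  congr 1
  funext i
  simp

theorem IsAlternatingQuasigroup.exists_odd (hf : IsAlternatingQuasigroup f) {a : Fin n → A}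
    (ha : a ∈ nct f) : ∃ τ : Equiv.Perm (Fin n), Equiv.Perm.sign τ = -1 ∧ f (a ∘ τ) ≠ f a := by
  have h : ∃ τ : Equiv.Perm (Fin n), f a ≠ f (a ∘ τ) := by
    by_contra! h
    exact ha h
  obtain ⟨τ, hτ⟩ := h
  exact ⟨τ, sign_eq_neg_one fun h => hτ (hf.apply_comp_even h a).symm, hτ.symm⟩

theorem IsAlternatingQuasigroup.apply_comp_odd_ne (hf : IsAlternatingQuasigroup f)
    {a : Fin n → A} (ha : a ∈ nct f) {σ : Equiv.Perm (Fin n)} (hσ : Equiv.Perm.sign σ = -1) :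
    f (a ∘ σ) ≠ f a := by
  obtain ⟨τ, hτ, h⟩ := hf.exists_odd ha
  rwa [hf.apply_comp_odd hσ hτ]

/-- Swapping two equal entries would be an odd permutation that fixes the tuple, hence its value. -/
theorem IsAlternatingQuasigroup.injective_of_mem_nct (hf : IsAlternatingQuasigroup f)
    {a : Fin n → A} (ha : a ∈ nct f) : Function.Injective a := by
  intro i j hij
  by_contra hne
  refine hf.apply_comp_odd_ne ha (Equiv.Perm.sign_swap hne) (congrArg f ?_)
  funext k
  rw [Function.comp_apply, Equiv.swap_apply_def]
  split_ifs with h1 h2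
  · rw [h1, hij]
  · rw [h2, hij]
  · rfl

theorem mem_nct_of_ne {a : Fin n → A} {σ : Equiv.Perm (Fin n)} (h : f (a ∘ σ) ≠ f a) :
    a ∈ nct f :=
  fun hc => h (hc σ).symm

theorem exists_perm_of_range_subset {a b : Fin n → A}
    (hb : Function.Injective b) (h : range b ⊆ range a) :
    ∃ σ : Equiv.Perm (Fin n), b = a ∘ σ := by
  choose s hs using fun i => h (mem_range_self i)
  have hinj : Function.Injective s := fun i j hij => hb (by rw [← hs i, ← hs j, hij])
  exact ⟨Equiv.ofBijective s (Finite.injective_iff_bijective.1 hinj),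
    funext fun i => (hs i).symm⟩

/-- Among rearrangements of a noncommuting tuple, the value detects the sign of the permutation. -/
theorem IsAlternatingQuasigroup.mk_eq_mk_iff (hf : IsAlternatingQuasigroup f) (a b : nct f) :
    Quotient.mk (nctSetoid f) a = Quotient.mk (nctSetoid f) b ↔
      range b.1 ⊆ range a.1 ∧ f b.1 = f a.1 := by
  rw [Quotient.eq]
  constructor
  · rintro ⟨σ, hσ, h⟩
    obtain h : b.1 = a.1 ∘ σ := funext h
    rw [h]
    exact ⟨range_comp_subset_range _ _,
      hf.apply_comp_even (Equiv.Perm.mem_alternatingGroup.1 hσ) _⟩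
  · rintro ⟨hr, hv⟩
    obtain ⟨σ, hσ⟩ := exists_perm_of_range_subset
      (hf.injective_of_mem_nct b.2) hr
    refine ⟨σ, Equiv.Perm.mem_alternatingGroup.2 ?_, fun i => congrFun hσ i⟩
    by_contra hs
    exact hf.apply_comp_odd_ne a.2 (sign_eq_neg_one hs) (hσ ▸ hv)

theorem finite_facetVertices (f : (Fin n → A) → A) (a : Fin n → A) :
    (facetVertices f a).Finite :=
  (finite_range _).insert _

/-- The vertex set of the facet given by an orbit of noncommuting tuples. -/
noncomputable def orbitFacet (hf : IsAlternatingQuasigroup f) (p : NCVert f) : Finset (A ⊕ A) :=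
  Quotient.lift (fun a : nct f => (finite_facetVertices f a.1).toFinset) (by
    intro a b hab
    have h := (hf.mk_eq_mk_iff a b).1 (Quotient.sound hab)
    have h' := (hf.mk_eq_mk_iff b a).1 (Quotient.sound hab).symm
    have hr : range a.1 = range b.1 := h'.1.antisymm h.1
    ext v
    simp only [Set.Finite.mem_toFinset, facetVertices, h.2,
      range_comp' Sum.inl, hr]) p

theorem inr_mem_orbitFacet {hf : IsAlternatingQuasigroup f} {a : nct f} {y : A} :
    Sum.inr y ∈ orbitFacet hf (Quotient.mk _ a) ↔ y = f a.1 := by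
  simp [orbitFacet, facetVertices]

theorem inl_mem_orbitFacet {hf : IsAlternatingQuasigroup f} {a : nct f} {y : A} :
    Sum.inl y ∈ orbitFacet hf (Quotient.mk _ a) ↔ y ∈ range a.1 := by
  simp [orbitFacet, facetVertices]

theorem card_orbitFacet (hf : IsAlternatingQuasigroup f) (p : NCVert f) :
    (orbitFacet hf p).card = n + 1 := by
  induction p using Quotient.inductionOn with
  | h a =>
    rw [← Set.ncard_coe_finset, orbitFacet, Quotient.lift_mk, Set.Finite.coe_toFinset,
      facetVertices, Set.ncard_insert_of_notMem (by simp) (finite_range _),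
      range_comp' Sum.inl, Set.ncard_image_of_injective _ Sum.inl_injective, ← image_univ,
      Set.ncard_image_of_injective _ (hf.injective_of_mem_nct a.2), Set.ncard_univ, Nat.card_fin]

theorem orbitFacet_injective (hf : IsAlternatingQuasigroup f) :
    Function.Injective (orbitFacet hf) := by
  intro p q h
  induction p, q using Quotient.inductionOn₂ with
  | h a b =>
    refine (hf.mk_eq_mk_iff a b).2 ⟨fun y hy => ?_, ?_⟩
    · rw [← inl_mem_orbitFacet (hf := hf), h]
      exact inl_mem_orbitFacet.2 hy
    · rw [← inr_mem_orbitFacet (hf := hf) (a := a), h]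
      exact inr_mem_orbitFacet.2 rfl

open scoped Classical

theorem erase_inr_subset_iff {hf : IsAlternatingQuasigroup f} {a b : nct f} :
    (orbitFacet hf (Quotient.mk _ a)).erase (Sum.inr (f a.1)) ⊆ orbitFacet hf (Quotient.mk _ b) ↔
      range a.1 ⊆ range b.1 := by
  constructor
  · intro h y hy
    exact inl_mem_orbitFacet.1 (h (Finset.mem_erase.2 ⟨by simp, inl_mem_orbitFacet.2 hy⟩))
  · rintro h (y | y) hy
    · exact inl_mem_orbitFacet.2 (h (inl_mem_orbitFacet.1 (Finset.mem_of_mem_erase hy)))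
    · obtain rfl := inr_mem_orbitFacet.1 (Finset.mem_of_mem_erase hy)
      exact absurd rfl (Finset.ne_of_mem_erase hy)

theorem erase_inl_subset_iff {hf : IsAlternatingQuasigroup f} {a b : nct f} {i : Fin n} :
    (orbitFacet hf (Quotient.mk _ a)).erase (Sum.inl (a.1 i)) ⊆ orbitFacet hf (Quotient.mk _ b) ↔
      f a.1 = f b.1 ∧ ∀ k ≠ i, a.1 k ∈ range b.1 := by
  have ha := hf.injective_of_mem_nct a.2
  constructor
  · intro h
    refine ⟨inr_mem_orbitFacet.1 (h (Finset.mem_erase.2 ⟨by simp, inr_mem_orbitFacet.2 rfl⟩)),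
      fun k hk => ?_⟩
    refine inl_mem_orbitFacet.1 (h (Finset.mem_erase.2
      ⟨fun h => hk (ha (Sum.inl_injective h)), inl_mem_orbitFacet.2 ⟨k, rfl⟩⟩))
  · rintro ⟨hv, h⟩ (y | y) hy
    · obtain ⟨k, rfl⟩ := inl_mem_orbitFacet.1 (Finset.mem_of_mem_erase hy)
      exact inl_mem_orbitFacet.2 (h k fun hk => Finset.ne_of_mem_erase hy (hk ▸ rfl))
    · rw [inr_mem_orbitFacet.1 (Finset.mem_of_mem_erase hy), hv]
      exact inr_mem_orbitFacet.2 rfl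

/-- The two facets which meet in the face opposite to the output vertex. -/
theorem IsAlternatingQuasigroup.existsUnique_erase_inr (hf : IsAlternatingQuasigroup f)
    (a : nct f) : ∃! q, q ≠ Quotient.mk (nctSetoid f) a ∧
      (orbitFacet hf (Quotient.mk _ a)).erase (Sum.inr (f a.1)) ⊆ orbitFacet hf q := by
  obtain ⟨τ, hτ, hne⟩ := hf.exists_odd a.2
  have hb : a.1 ∘ τ ∈ nct f := by
    refine mem_nct_of_ne (σ := τ⁻¹) ?_
    have : (a.1 ∘ τ) ∘ (τ⁻¹ : Equiv.Perm (Fin n)) = a.1 := by funext i; simp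
    rw [this]
    exact hne.symm
  refine ⟨Quotient.mk _ ⟨a.1 ∘ τ, hb⟩, ⟨fun h => hne ((hf.mk_eq_mk_iff _ _).1 h).2.symm,
    erase_inr_subset_iff.2 ?_⟩, fun q hq => ?_⟩
  · rintro _ ⟨i, rfl⟩
    exact ⟨τ⁻¹ i, by simp⟩
  · induction q using Quotient.inductionOn with
    | h c =>
      obtain ⟨hca, hsub⟩ := hq
      have hac := erase_inr_subset_iff.1 hsub
      have hinj := hf.injective_of_mem_nct a.2
      obtain ⟨σ, hσ⟩ := exists_perm_of_range_subset hinj hac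
      have hc : c.1 = a.1 ∘ (σ⁻¹ : Equiv.Perm (Fin n)) := by
        rw [hσ]
        funext i
        simp
      have hca' : range c.1 ⊆ range a.1 := hc ▸ range_comp_subset_range _ _
      refine (hf.mk_eq_mk_iff _ _).2 ⟨(range_comp_subset_range τ a.1).trans hac, ?_⟩
      have hodd : Equiv.Perm.sign σ⁻¹ = -1 := by
        refine sign_eq_neg_one fun h => hca ((hf.mk_eq_mk_iff _ _).2 ⟨hac, ?_⟩)
        rw [hc, hf.apply_comp_even h]
      rw [hc]
      exact hf.apply_comp_odd hτ hodd a.1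

/-- The two facets which meet in a face opposite to an input vertex. -/
theorem IsAlternatingQuasigroup.existsUnique_erase_inl (hf : IsAlternatingQuasigroup f)
    (a : nct f) (i : Fin n) : ∃! q, q ≠ Quotient.mk (nctSetoid f) a ∧
      (orbitFacet hf (Quotient.mk _ a)).erase (Sum.inl (a.1 i)) ⊆ orbitFacet hf q := by
  obtain ⟨τ, hτ, hne⟩ := hf.exists_odd a.2
  have ha := hf.injective_of_mem_nct a.2
  have hupd : ∀ z, Function.update (a.1 ∘ τ) (τ⁻¹ i) z = Function.update a.1 i z ∘ τ := by
    intro z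
    rw [Function.update_comp_equiv]
    rfl
  have hupda : ∀ z, f (Function.update a.1 i z) = f a.1 → z = a.1 i := fun z hz =>
    (hf.quasigroup i a.1 (f a.1)).unique hz (by rw [Function.update_eq_self])
  -- The entry `a.1 i` sits at place `τ⁻¹ i` of `a.1 ∘ τ`; it is replaced so that the odd
  -- rearrangement regains the value `f a.1`.
  obtain ⟨z, hz, hzu⟩ := hf.quasigroup (τ⁻¹ i) (a.1 ∘ τ) (f a.1)
  rw [hupd] at hz
  have hza : z ≠ a.1 i := by
    rintro rfl
    rw [Function.update_eq_self] at hz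
    exact hne hz
  have hb : Function.update a.1 i z ∘ τ ∈ nct f := by
    refine mem_nct_of_ne (σ := τ⁻¹) ?_
    have : (Function.update a.1 i z ∘ τ) ∘ (τ⁻¹ : Equiv.Perm (Fin n)) =
        Function.update a.1 i z := by funext k; simp
    rw [this, hz]
    exact fun h => hza (hupda z h)
  refine ⟨Quotient.mk _ ⟨_, hb⟩, ⟨fun h => ?_, erase_inl_subset_iff.2 ⟨hz.symm, fun k hk => ?_⟩⟩,
    fun q hq => ?_⟩
  · obtain ⟨k, hk⟩ := ((hf.mk_eq_mk_iff _ _).1 h).1 ⟨i, rfl⟩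
    have hki : Function.update a.1 i z (τ k) = a.1 i := hk
    by_cases h' : τ k = i
    · rw [h', Function.update_self] at hki
      exact hza hki
    · rw [Function.update_of_ne h'] at hki
      exact h' (ha hki)
  · exact ⟨τ⁻¹ k, by simp [Function.update_of_ne hk]⟩
  · induction q using Quotient.inductionOn with
    | h c =>
      obtain ⟨hca, hsub⟩ := hq
      obtain ⟨hv, hmem⟩ := erase_inl_subset_iff.1 hsub
      have hc := hf.injective_of_mem_nct c.2
      have hai : a.1 i ∉ range c.1 := by
        intro h
        refine hca ((hf.mk_eq_mk_iff _ _).2 ⟨?_, hv⟩)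
        rintro _ ⟨k, rfl⟩
        by_cases hk : k = i
        · exact hk ▸ h
        · exact hmem k hk
      obtain ⟨j, hj⟩ : ∃ j, c.1 j ∉ range a.1 := by
        by_contra! h
        obtain ⟨σ, hσ⟩ := exists_perm_of_range_subset hc (by rintro _ ⟨j, rfl⟩; exact h j)
        exact hai ⟨σ⁻¹ i, by simp [hσ]⟩
      have hinj : Function.Injective (Function.update a.1 i (c.1 j)) := by
        intro k l hkl
        by_contra hne
        by_cases hk : k = i
        · subst hk
          rw [Function.update_self, Function.update_of_ne (Ne.symm hne)] at hkl
          exact hj ⟨l, hkl.symm⟩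
        · by_cases hl : l = i
          · subst hl
            rw [Function.update_self, Function.update_of_ne hk] at hkl
            exact hj ⟨k, hkl⟩
          · rw [Function.update_of_ne hk, Function.update_of_ne hl] at hkl
            exact hne (ha hkl)
      obtain ⟨σ, hσ⟩ := exists_perm_of_range_subset hinj (by
        rintro _ ⟨k, rfl⟩
        by_cases hk : k = i
        · rw [hk, Function.update_self]
          exact ⟨j, rfl⟩
        · rw [Function.update_of_ne hk]
          exact hmem k hk)
      have hcσ : c.1 = Function.update a.1 i (c.1 j) ∘ (σ⁻¹ : Equiv.Perm (Fin n)) := by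
        rw [hσ]
        funext k
        simp
      -- If even, `a.1` with `c.1 j` in place `i` would keep the value `f a.1`, forcing `c.1 j = a.1
      -- i`. Being odd, `c.1` satisfies the equation that defines `z`.
      have hodd : Equiv.Perm.sign σ⁻¹ = -1 := by
        refine sign_eq_neg_one fun h => hai ⟨j, hupda _ ?_⟩
        rw [hv, ← hf.apply_comp_even h, ← hcσ]
      have hjz : c.1 j = z := hzu _ (by
        beta_reduce
        rw [hupd, hf.apply_comp_odd hτ hodd, ← hcσ, hv])
      refine (hf.mk_eq_mk_iff _ _).2 ⟨?_, hz.trans hv⟩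
      refine (range_comp_subset_range τ (Function.update a.1 i z)).trans ?_
      rw [← hjz, hσ]
      exact range_comp_subset_range _ _

theorem IsAlternatingQuasigroup.isPseudomanifold (hf : IsAlternatingQuasigroup f) :
    IsPseudomanifold n (orbitFacet hf) where
  injective := orbitFacet_injective hf
  card := card_orbitFacet hf
  existsUnique p w hw := by
    induction p using Quotient.inductionOn with
    | h a =>
      rcases w with y | y
      · obtain ⟨i, rfl⟩ := inl_mem_orbitFacet.1 hw
        convert hf.existsUnique_erase_inl a i
      · obtain rfl := inr_mem_orbitFacet.1 hw
        convert hf.existsUnique_erase_inr a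

theorem mem_faces_simplicization_iff (hf : IsAlternatingQuasigroup f) (γ : Finset (A ⊕ A)) :
    γ ∈ (simplicization f).faces ↔ γ.Nonempty ∧ ∃ p, γ ⊆ orbitFacet hf p := by
  refine and_congr_right fun _ => ⟨?_, ?_⟩
  · rintro ⟨a, ha, h⟩
    refine ⟨Quotient.mk _ ⟨a, ha⟩, fun v hv => ?_⟩
    exact (Set.Finite.mem_toFinset _).2 (h hv)
  · rintro ⟨p, h⟩
    induction p using Quotient.inductionOn with
    | h a => exact ⟨a.1, a.2, fun v hv => (Set.Finite.mem_toFinset _).1 (h hv)⟩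

/-- Omitting the output vertex matches equal sets of entries; omitting an input vertex matches equal
values with `n - 1` common entries. The counts rest on injectivity of noncommuting tuples. -/
theorem ncGraph_adj_iff (hn : 1 ≤ n) (hf : IsAlternatingQuasigroup f) (p q : NCVert f) :
    (ncGraph f).Adj p q ↔
      p ≠ q ∧ ∃ w ∈ orbitFacet hf p, (orbitFacet hf p).erase w ⊆ orbitFacet hf q := by
  have hcard : ∀ a : nct f, (range a.1).ncard = n := fun a => by
    rw [← image_univ, Set.ncard_image_of_injective _ (hf.injective_of_mem_nct a.2),
      Set.ncard_univ, Nat.card_fin]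
  refine and_congr_right fun hne => ⟨?_, ?_⟩
  · rintro ⟨a, b, rfl, rfl, h | ⟨hv, h⟩⟩
    · exact ⟨_, inr_mem_orbitFacet.2 rfl, erase_inr_subset_iff.2 h.subset⟩
    · have hd : (range a.1 \ range b.1).ncard = 1 := by
        have := Set.ncard_inter_add_ncard_sdiff_eq_ncard (range a.1) (range b.1) (finite_range _)
        rw [hcard, h] at this
        omega
      obtain ⟨y, hy⟩ := Set.ncard_eq_one.1 hd
      obtain ⟨i, rfl⟩ : y ∈ range a.1 := (hy.superset rfl).1
      refine ⟨_, inl_mem_orbitFacet.2 ⟨i, rfl⟩, erase_inl_subset_iff.2 ⟨hv, fun k hk => ?_⟩⟩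
      by_contra hkb
      exact hk (hf.injective_of_mem_nct a.2 (hy.subset ⟨⟨k, rfl⟩, hkb⟩))
  · rintro ⟨w, hw, hsub⟩
    induction p, q using Quotient.inductionOn₂ with
    | h a b =>
      refine ⟨a, b, rfl, rfl, ?_⟩
      rcases w with y | y
      · obtain ⟨i, rfl⟩ := inl_mem_orbitFacet.1 hw
        obtain ⟨hv, hmem⟩ := erase_inl_subset_iff.1 hsub
        refine Or.inr ⟨hv, ?_⟩
        have hi : a.1 i ∉ range b.1 := fun h => hne <| Eq.symm <|
          (hf.mk_eq_mk_iff _ _).2 ⟨by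
            rintro _ ⟨k, rfl⟩
            by_cases hk : k = i
            · exact hk ▸ h
            · exact hmem k hk, hv⟩
        have heq : range a.1 ∩ range b.1 = range a.1 \ {a.1 i} := by
          ext y
          refine ⟨fun hy => ⟨hy.1, fun h => hi (mem_singleton_iff.1 h ▸ hy.2)⟩, ?_⟩
          rintro ⟨⟨k, rfl⟩, hk⟩
          exact ⟨⟨k, rfl⟩, hmem k fun h => hk (h ▸ rfl)⟩
        rw [heq, Set.ncard_sdiff_singleton_of_mem (mem_range_self i), hcard]
      · obtain rfl := inr_mem_orbitFacet.1 hw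
        have h := erase_inr_subset_iff.1 hsub
        exact Or.inl (Set.eq_of_subset_of_ncard_le h (by rw [hcard, hcard]) (finite_range _))

end Alternating

theorem mainTheorem6 {n : ℕ} (hn : 1 ≤ n) {A : Type u} (f : (Fin n → A) → A)
    (hf : IsAlternatingQuasigroup f) :
    ∃ ι : graphGeo (ncGraph f) → openSerenation f,
      IsEmbedding ι ∧ IsStrongDeformationRetract (range ι) := by
  rw [graphGeo_eq_halfEdges hf.isPseudomanifold
    (fun p q => by convert ncGraph_adj_iff hn hf p q), openSerenation,
    openGeo_eq_cells hn (card_orbitFacet hf) (mem_faces_simplicization_iff hf)]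
  exact hf.isPseudomanifold.exists_isStrongDeformationRetract hn
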